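/- Let $A=\mathbf F_q[T]$, let $L$ be a finite field containing $\mathbf F_q$, let $\gamma:A\to L$ be an $\mathbf F_q$-algebra homomorphism with kernel $(P)$, and let $m=[L:A/P]$. Let $L\{\tau\}$ be the Ore polynomial ring with $\tau\lambda=\lambda^q\tau$ for $\lambda\in L$, and let $\Phi:A\to L\{\tau\}$ be a Drinfeld $A$-module of rank $2$, that is, the $\mathbf F_q$-algebra homomorphism with $\Phi(T)=\gamma(T)+a_2\tau+a_3\tau^2$, where $a_2,a_3\in L$ and $a_3\neq 0$. For a commutative $L$-algebra $B$ let $B^\Phi$ be the additive group of $B$ with the $A$-module structure given by $\Phi$, $\tau$ acting as $x\mapsto x^q$. Let $\overline L$ be an algebraic closure of $L$, let $F:x\mapsto x^{|L|}$ be the Frobenius of $L$, and let $P_\Phi(X)=X^2-cX+\mu P^m$, with $c\in A$ and $\mu\in\mathbf F_q^*$, be its characteristic polynomial, that is, the characteristic polynomial of $F$ acting on the $\ell$-adic Tate module $T_\ell(\Phi)=\varprojlim_k\{x\in\overline L^{\Phi}:\ell^k x=0\}$ (free of rank $2$ over the completion of $A$ at $\ell$), where $\ell$ is any irreducible element of $A$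 not divisible by $P$. If $i_1,i_2\in A$ satisfy $i_2\mid i_1$ and $L^\Phi\simeq A/(i_1)\oplus A/(i_2)$ as $A$-modules, then $i_2$ divides $c-2$ in $A$. -/

import Mathlib

open Polynomial

noncomputable section

/-! ### Tate modules of modules over a commutative ring -/

section Tate

variable (R : Type*) [CommRing R] (M : Type*) [AddCommGroup M] [Module R M] (l : R)

/-- The `l`-adic Tate module of the `R`-module `M`: sequences `(x₀, x₁, x₂, …)` with
`xₙ ∈ M[lⁿ]` and `l • xₙ₊₁ = xₙ`. -/
def tateModule : AddSubgroup (∀ n : ℕ, Submodule.torsionBySet R M ↑(Ideal.span {l} ^ n)) where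
  carrier := {x | ∀ n : ℕ, l • (x (n + 1) : M) = (x n : M)}
  zero_mem' := fun n => by simp
  add_mem' := fun {x y} hx hy n => by
    have h1 := hx n
    have h2 := hy n
    simp [smul_add, h1, h2]
  neg_mem' := fun {x} hx n => by
    have h1 := hx n
    simp [h1]

variable {R M l}

theorem tateModule_smul_mem (a : AdicCompletion (Ideal.span {l}) R) (x : tateModule R M l) :
    (fun n : ℕ => AdicCompletion.evalₐ (Ideal.span {l}) n a • x.1 n) ∈ tateModule R M l := by
  intro n
  induction a using AdicCompletion.induction_on with
  | h r =>
    have hx := x.2 n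
    have hr := AdicCompletion.Ideal.mk_eq_mk (Ideal.span {l}) (Nat.le_succ n) r
    simp only [AdicCompletion.evalₐ_mk]
    rw [← hr, Submodule.torsionBySet.mk_smul, Submodule.torsionBySet.mk_smul,
      Submodule.coe_smul, Submodule.coe_smul, smul_comm, hx]

/-- The `l`-adic completion `R_l` of `R` acts on the Tate module: on the `n`-th component, which
is killed by `lⁿ`, through the quotient `R_l → R / lⁿ`. -/
instance tateModule.instModule :
    Module (AdicCompletion (Ideal.span {l}) R) (tateModule R M l) where
  smul a x := ⟨fun n => AdicCompletion.evalₐ (Ideal.span {l}) n a • x.1 n,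
    tateModule_smul_mem a x⟩
  one_smul x := Subtype.ext <| funext fun n => by
    change AdicCompletion.evalₐ (Ideal.span {l}) n 1 • x.1 n = x.1 n
    rw [map_one, one_smul]
  mul_smul a b x := Subtype.ext <| funext fun n => by
    change AdicCompletion.evalₐ (Ideal.span {l}) n (a * b) • x.1 n =
      AdicCompletion.evalₐ (Ideal.span {l}) n a • AdicCompletion.evalₐ (Ideal.span {l}) n b • x.1 n
    rw [map_mul, mul_smul]
  smul_zero a := Subtype.ext <| funext fun n => smul_zero _
  smul_add a x y := Subtype.ext <| funext fun n => smul_add _ _ _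
  add_smul a b x := Subtype.ext <| funext fun n => by
    change AdicCompletion.evalₐ (Ideal.span {l}) n (a + b) • x.1 n =
      AdicCompletion.evalₐ (Ideal.span {l}) n a • x.1 n +
        AdicCompletion.evalₐ (Ideal.span {l}) n b • x.1 n
    rw [map_add, add_smul]
  zero_smul x := Subtype.ext <| funext fun n => by
    change AdicCompletion.evalₐ (Ideal.span {l}) n 0 • x.1 n = 0
    rw [map_zero, zero_smul]

theorem tateModule.coe_smul_apply (a : AdicCompletion (Ideal.span {l}) R) (x : tateModule R M l)
    (n : ℕ) : (a • x).1 n = AdicCompletion.evalₐ (Ideal.span {l}) n a • x.1 n :=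
  rfl

/-- The `R_l`-linear endomorphism of the Tate module induced by an endomorphism `f` of `M`,
`(xₙ)ₙ ↦ (f xₙ)ₙ`. -/
def tateModule.map (f : M →ₗ[R] M) :
    tateModule R M l →ₗ[AdicCompletion (Ideal.span {l}) R] tateModule R M l where
  toFun x := ⟨fun n => ⟨f (x.1 n : M), by
      have h := (Submodule.mem_torsionBySet_iff _ _).1 (x.1 n).2
      refine (Submodule.mem_torsionBySet_iff _ _).2 fun a => ?_
      rw [← map_smul, h a, map_zero]⟩, fun n => by
      change l • f (x.1 (n + 1) : M) = f (x.1 n : M)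
      rw [← map_smul, x.2 n]⟩
  map_add' x y := Subtype.ext <| funext fun n => Subtype.ext <| map_add f _ _
  map_smul' a x := Subtype.ext <| funext fun n => Subtype.ext <| by
    obtain ⟨r, hr⟩ := Ideal.Quotient.mk_surjective (AdicCompletion.evalₐ (Ideal.span {l}) n a)
    simp only [RingHom.id_apply, tateModule.coe_smul_apply, ← hr,
      Submodule.torsionBySet.mk_smul, Submodule.coe_smul, map_smul]

end Tate

/-! ### Drinfeld modules of rank two -/

/-- A Drinfeld `𝔽_q[T]`-module `Φ` of rank two over the `𝔽_q[T]`-field `(L, γ)`. The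
`𝔽_q`-algebra homomorphism `Φ : 𝔽_q[T] → L{τ}`, `τ λ = λ^q τ`, is given by its value
`Φ(T) = γ(T) + a₂ τ + a₃ τ²` with `a₃ ≠ 0`, which can be prescribed freely. -/
structure RankTwoDrinfeldModule {Fq L : Type*} [Field Fq] [Field L] [Algebra Fq L]
    (γ : Fq[X] →ₐ[Fq] L) where
  a₂ : L
  a₃ : L
  a₃_ne_zero : a₃ ≠ 0

namespace RankTwoDrinfeldModule

variable {Fq L : Type*} [Field Fq] [Fintype Fq] [Field L] [Algebra Fq L] {γ : Fq[X] →ₐ[Fq] L}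
  (Φ : RankTwoDrinfeldModule γ)
  (B : Type*) [CommRing B] [Algebra Fq B] [Algebra L B] [IsScalarTower Fq L B]

/-- The action of `Φ(T)` on an `L`-algebra `B`: `x ↦ γ(T) x + a₂ x^q + a₃ x^(q²)`. -/
def actT : B →ₗ[Fq] B :=
  γ X • LinearMap.id + Φ.a₂ • (FiniteField.frobeniusAlgHom Fq B).toLinearMap +
    Φ.a₃ • ((FiniteField.frobeniusAlgHom Fq B).toLinearMap ^ 2)

theorem actT_apply (x : B) :
    Φ.actT B x = γ X • x + Φ.a₂ • x ^ Fintype.card Fq + Φ.a₃ • x ^ (Fintype.card Fq ^ 2) := by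
  simp [actT, pow_two, pow_mul]

/-- The `𝔽_q[T]`-module `B^Φ`: the additive group of the `L`-algebra `B`, on which
`a ∈ 𝔽_q[T]` acts through `Φ(a)`. -/
abbrev points : Type _ :=
  Module.AEval' (Φ.actT B)

variable [Fintype L]

/-- The Frobenius `F : x ↦ x^#L` of `L` commutes with the action of `𝔽_q[T]`, and so is an
endomorphism of `B^Φ`. -/
def frobenius : Φ.points B →ₗ[Fq[X]] Φ.points B :=
  LinearMap.ofAEval (Φ.actT B)
    ((Module.AEval'.of (Φ.actT B)).toLinearMap ∘ₗ
      ((FiniteField.frobeniusAlgHom L B).restrictScalars Fq).toLinearMap)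
    (fun x => by
      rw [LinearMap.comp_apply, LinearMap.comp_apply, LinearEquiv.coe_coe,
        Module.AEval'.X_smul_of]
      congr 1
      change FiniteField.frobeniusAlgHom L B (Φ.actT B x) =
        Φ.actT B (FiniteField.frobeniusAlgHom L B x)
      simp only [actT_apply, map_add, map_smul, map_pow])

theorem frobenius_of (x : B) :
    Φ.frobenius B (Module.AEval'.of (Φ.actT B) x) =
      Module.AEval'.of (Φ.actT B) (x ^ Fintype.card L) :=
  rfl

/-- `f ∈ 𝔽_q[T][X]` is the characteristic polynomial of the Frobenius `F` of `L` acting on the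
Tate module `T_l(Φ)` of `Φ(L̄)`, which for a prime `l` different from the characteristic of `L` is
free of rank two over the completion of `𝔽_q[T]` at `l`: the matrix of `F` in a basis of `T_l(Φ)`
has characteristic polynomial `f`. -/
def IsFrobeniusCharpoly (l : Fq[X]) (f : Fq[X][X]) : Prop :=
  ∃ b : Module.Basis (Fin 2) (AdicCompletion (Ideal.span {l}) Fq[X])
      (tateModule Fq[X] (Φ.points (AlgebraicClosure L)) l),
    (LinearMap.toMatrix b b (tateModule.map (Φ.frobenius (AlgebraicClosure L)))).charpoly =
      f.map (algebraMap Fq[X] (AdicCompletion (Ideal.span {l}) Fq[X]))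

end RankTwoDrinfeldModule

end

/-! Write `A = Fq[X]`, `W` for the points of `Φ` over the algebraic closure, `i = i₂` and `N = μ
P^m`. Since `i₂ ∣ i₁`, `L^Φ` contains a copy of `(A/i)²`, which by counting is all of `W[i]`; hence
`F = 1` on `W[i]` (`hasFullTorsion_and_frobenius_eq`). The characteristic polynomial is given at the
single prime `l`, unrelated to `i`, so the trace of `F` cannot simply be read off modulo `i`.
Instead, Cayley-Hamilton on the Tate module yields `F² - cF + N = 0` on all of `W`
(`frobenius_sq_sub_add_eq_zero`), and the argument continues in `End_A(W)`.

Put `d = gcd(i, c - 2)`, `i = dj`, `c - 2 = dm`. Then `F = 1 + dG` with `G` divisible by `j`, and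
`G² - mG + N' = 0` with `m` invertible modulo `j`. By Hensel lifting `G`, hence `F`, is a scalar on
`W[j^n]` for every `n` (`dvd_or_exists_scalar_congr`). If `j` is constant, `i ∣ c - 2`. Otherwise
comparing polynomial degrees with the order of `W[j^n]` shows that `F = Φ(a)` for some `a`
(`exists_frobenius_eq_smul`). Then `c = 2a`, and `F = 1` on `W[i]` gives `i ∣ a - 1`, so `i ∣ 2(a -
1) = c - 2`. -/

noncomputable section

/-! ### Torsion and endomorphisms of divisible modules. -/

section Torsion

variable {R W : Type*} [CommRing R] [AddCommGroup W] [Module R W]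

theorem card_torsionBy_mul {a : R} (ha : Function.Surjective fun x : W => a • x) (b : R) :
    Nat.card (Submodule.torsionBy R W (a * b)) =
      Nat.card (Submodule.torsionBy R W a) * Nat.card (Submodule.torsionBy R W b) := by
  let f : Submodule.torsionBy R W (a * b) →ₗ[R] Submodule.torsionBy R W b :=
    (LinearMap.lsmul R W a).restrict fun x hx => by
      rw [Submodule.mem_torsionBy_iff] at hx ⊢
      rw [LinearMap.lsmul_apply, smul_smul, mul_comm, hx]
  have hf : Function.Surjective f := by
    rintro ⟨y, hy⟩
    obtain ⟨x, rfl⟩ := ha y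
    refine ⟨⟨x, ?_⟩, rfl⟩
    rw [Submodule.mem_torsionBy_iff] at hy ⊢
    rw [mul_comm, mul_smul, hy]
  have e : LinearMap.ker f ≃ Submodule.torsionBy R W a :=
    { toFun := fun x => ⟨x.1.1, congrArg Subtype.val (LinearMap.mem_ker.1 x.2)⟩
      invFun := fun x => ⟨⟨x.1, by
        have hx := (Submodule.mem_torsionBy_iff a x.1).1 x.2
        rw [Submodule.mem_torsionBy_iff, mul_comm, mul_smul, hx, smul_zero]⟩,
        Subtype.ext ((Submodule.mem_torsionBy_iff a x.1).1 x.2)⟩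
      left_inv := fun _ => rfl
      right_inv := fun _ => rfl }
  rw [Submodule.card_eq_card_quotient_mul_card (LinearMap.ker f), Nat.card_congr e,
    Nat.card_congr (f.quotKerEquivOfSurjective hf).toEquiv, mul_comm]

/-- `f` factors through `W / W[a]`, which multiplication by `a` identifies with `W`. -/
theorem exists_eq_smul_of_torsionBy_le_ker {a : R}
    (ha : Function.Surjective fun x : W => a • x) {f : W →ₗ[R] W}
    (hf : ∀ x : W, a • x = 0 → f x = 0) : ∃ g : W →ₗ[R] W, ∀ x, f x = a • g x := by
  let m : W →ₗ[R] W := LinearMap.lsmul R W a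
  have hm : Function.Surjective m := ha
  refine ⟨(LinearMap.ker m).liftQ f (fun x hx => hf x hx) ∘ₗ
    (m.quotKerEquivOfSurjective hm).symm.toLinearMap, fun x => ?_⟩
  rw [← map_smul]
  have : (m.quotKerEquivOfSurjective hm).symm (a • x) = (LinearMap.ker m).mkQ x := by
    rw [LinearEquiv.symm_apply_eq]; rfl
  rw [LinearMap.comp_apply, LinearEquiv.coe_coe, this]
  rfl

theorem eq_zero_of_forall_smul_eq_zero {a : R} (ha : Function.Surjective fun x : W => a • x)
    {f : W →ₗ[R] W} (hf : ∀ x, a • f x = 0) (x : W) : f x = 0 := by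
  obtain ⟨y, rfl⟩ := ha x
  simpa using hf y

/-- Hensel lifting in the endomorphism ring of a `v`-divisible module: if `G ≡ 0` modulo `v` is a
root of `X² - kX + N` with `k` invertible modulo `v`, then `G` is congruent to a scalar modulo
every power of `v`. -/
theorem exists_scalar_congr_pow {v k u w N : R} (huw : u * k + w * v = 1)
    (hv : ∀ n, Function.Surjective fun x : W => v ^ n • x)
    (hdvd : ∀ n a, (∀ x : W, v ^ n • x = 0 → a • x = 0) → v ^ n ∣ a)
    {G : W →ₗ[R] W} (hG : ∀ x, G (G x) - k • G x + N • x = 0)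
    {g : W →ₗ[R] W} (hg : ∀ x, G x = v • g x) (n : ℕ) :
    ∃ (b : R) (h : W →ₗ[R] W), v ∣ b ∧ ∀ x, G x = b • x + v ^ (n + 1) • h x := by
  induction n with
  | zero => exact ⟨0, g, dvd_zero v, fun x => by simp [hg]⟩
  | succ n ih =>
    -- Carrying `v ∣ b` through the induction makes the cross term `2bh` vanish modulo `v`.
    obtain ⟨b, h, ⟨b', rfl⟩, hb⟩ := ih
    have key : ∀ x, ((v * b') ^ 2 - k * (v * b') + N) • x + v ^ (n + 1) •
        ((2 * (v * b')) • h x + v ^ (n + 1) • h (h x) - k • h x) = 0 := fun x => by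
      rw [← hG x]
      simp only [hb, map_add, map_smul]
      module
    obtain ⟨r, hr⟩ := hdvd (n + 1) ((v * b') ^ 2 - k * (v * b') + N) fun x hx => by
      have h1 : v ^ (n + 1) • h x = 0 := by rw [← map_smul, hx, map_zero]
      have h2 : v ^ (n + 1) • h (h x) = 0 := by rw [← map_smul, ← map_smul, hx, map_zero, map_zero]
      have := key x
      rw [smul_sub, smul_add, smul_comm, h1, h2, smul_comm _ k, h1] at this
      simpa [h2] using this
    have key2 : ∀ x, (r • LinearMap.id + ((2 * (v * b')) • h + v ^ (n + 1) • (h ∘ₗ h) - k • h) :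
        W →ₗ[R] W) x = 0 := by
      refine eq_zero_of_forall_smul_eq_zero (hv (n + 1)) fun x => ?_
      rw [← key x, hr]
      simp only [LinearMap.add_apply, LinearMap.sub_apply, LinearMap.smul_apply, LinearMap.id_apply,
        LinearMap.comp_apply]
      module
    -- By `key2`, `kh = r + 2bh + v^(n+1)h²`, so `kh ≡ r` modulo `v`. As `u` inverts `k` modulo `v`,
    -- `h ≡ ur`, which is the next digit of `b`.
    refine ⟨v * b' + v ^ (n + 1) * (u * r),
      (u * (2 * b')) • h + (u * v ^ n) • (h ∘ₗ h) + w • h, ?_, fun x => ?_⟩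
    · exact dvd_add (dvd_mul_right _ _) ((dvd_pow_self v n.succ_ne_zero).mul_right _)
    · rw [hb]
      have h3 : h x = (u * r) • x + v • ((u * (2 * b')) • h x + (u * v ^ n) • h (h x) + w • h x) := by
        have h4 := key2 x
        simp only [LinearMap.add_apply, LinearMap.sub_apply, LinearMap.smul_apply,
          LinearMap.id_apply, LinearMap.comp_apply] at h4
        have h5 : h x = (u * k + w * v) • h x + u • (0 : W) := by rw [huw]; simp
        rw [← h4] at h5
        refine h5.trans ?_
        module
      simp only [LinearMap.add_apply, LinearMap.smul_apply, LinearMap.comp_apply]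
      conv_lhs => rw [h3]
      module

end Torsion

/-! ### Modules over `k[X]` with bounded torsion, and the dichotomy for `F`. -/

section FullTorsion

variable {k : Type*} [Field k] (Q : ℕ) (W : Type*) [AddCommGroup W] [Module k[X] W]

/-- The `k[X]`-module `W` is divisible, and for `a ≠ 0` its `a`-torsion has order at most
`Q ^ deg a`. -/
structure HasBoundedTorsion : Prop where
  one_lt : 1 < Q
  surjective_smul : ∀ a : k[X], a ≠ 0 → Function.Surjective fun x : W => a • x
  finite_torsionBy : ∀ a : k[X], a ≠ 0 → Finite (Submodule.torsionBy k[X] W a)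
  card_torsionBy_le : ∀ a : k[X], a ≠ 0 →
    Nat.card (Submodule.torsionBy k[X] W a) ≤ Q ^ a.natDegree

/-- The `a`-torsion of `W` has the largest possible order. -/
def HasFullTorsion (a : k[X]) : Prop :=
  a ≠ 0 ∧ Nat.card (Submodule.torsionBy k[X] W a) = Q ^ a.natDegree

variable {Q W}

namespace HasFullTorsion

theorem mul (hW : HasBoundedTorsion (k := k) Q W) {a b : k[X]} (ha : HasFullTorsion Q W a)
    (hb : HasFullTorsion Q W b) : HasFullTorsion Q W (a * b) :=
  ⟨mul_ne_zero ha.1 hb.1, by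
    rw [card_torsionBy_mul (hW.surjective_smul a ha.1), ha.2, hb.2,
      natDegree_mul ha.1 hb.1, pow_add]⟩

theorem pow (hW : HasBoundedTorsion (k := k) Q W) {a : k[X]} (ha : HasFullTorsion Q W a)
    (n : ℕ) : HasFullTorsion Q W (a ^ n) := by
  induction n with
  | zero =>
    refine ⟨by simp, ?_⟩
    have : Submodule.torsionBy k[X] W (1 : k[X]) = ⊥ := by
      ext x; simp
    simp [this]
  | succ n ih => rw [pow_succ]; exact ih.mul hW ha

/-- Torsion orders and bounds are both multiplicative, so equality for a product forces equality for
each factor. -/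
theorem of_mul_left (hW : HasBoundedTorsion (k := k) Q W) {a b : k[X]}
    (h : HasFullTorsion Q W (a * b)) : HasFullTorsion Q W a := by
  have ha := left_ne_zero_of_mul h.1
  have hb := right_ne_zero_of_mul h.1
  refine ⟨ha, (hW.card_torsionBy_le a ha).antisymm ?_⟩
  have h2 := h.2
  rw [card_torsionBy_mul (hW.surjective_smul a ha), natDegree_mul ha hb, pow_add] at h2
  have hpos : 0 < Q ^ b.natDegree := pow_pos (zero_lt_one.trans hW.one_lt) _
  refine Nat.le_of_mul_le_mul_right ?_ hpos
  rw [← h2]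
  exact Nat.mul_le_mul_left _ (hW.card_torsionBy_le b hb)

/-- By Bézout `W[a]` lies in `W[gcd(a, b)]`; the bound on the latter forces the gcd to have the
degree of `a`. -/
theorem dvd (hW : HasBoundedTorsion (k := k) Q W) {a b : k[X]} (ha : HasFullTorsion Q W a)
    (h : ∀ x : W, a • x = 0 → b • x = 0) : a ∣ b := by
  classical
  have hg : EuclideanDomain.gcd a b ≠ 0 := fun h0 => ha.1 (EuclideanDomain.gcd_eq_zero_iff.1 h0).1
  have hle : Submodule.torsionBy k[X] W a ≤
      Submodule.torsionBy k[X] W (EuclideanDomain.gcd a b) := fun x hx => by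
    rw [Submodule.mem_torsionBy_iff] at hx ⊢
    rw [EuclideanDomain.gcd_eq_gcd_ab, add_smul, mul_comm a, mul_comm b, mul_smul, mul_smul, hx,
      h x hx, smul_zero, smul_zero, add_zero]
  have := hW.finite_torsionBy _ hg
  have hcard := (Nat.card_le_card_of_injective _ (Submodule.inclusion_injective hle)).trans
    (hW.card_torsionBy_le _ hg)
  rw [ha.2, Nat.pow_le_pow_iff_right hW.one_lt] at hcard
  obtain ⟨t, ht⟩ := EuclideanDomain.gcd_dvd_left a b
  have ht0 : t ≠ 0 := fun h0 => ha.1 (by rw [ht, h0, mul_zero])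
  have hdeg : t.natDegree = 0 := by
    have := congrArg natDegree ht
    rw [natDegree_mul hg ht0] at this
    omega
  have hu : IsUnit t := isUnit_iff_degree_eq_zero.2 (by rw [degree_eq_natDegree ht0, hdeg]; rfl)
  have hassoc : Associated (EuclideanDomain.gcd a b) a := ⟨hu.unit, by simpa using ht.symm⟩
  exact hassoc.symm.dvd.trans (EuclideanDomain.gcd_dvd_right a b)

end HasFullTorsion

/-- If `F` is the identity on the full `i`-torsion of `W` and a root of `X² - cX + N`, then either
`i` divides `c - 2`, or `F` acts as a scalar on the `j ^ n`-torsion for some nonconstant `j` and all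
`n`. -/
theorem dvd_or_exists_scalar_congr (hW : HasBoundedTorsion (k := k) Q W) {i c N : k[X]}
    (hi : HasFullTorsion Q W i) {F : W →ₗ[k[X]] W}
    (hF : ∀ x, F (F x) - c • F x + N • x = 0) (hFi : ∀ x : W, i • x = 0 → F x = x) :
    i ∣ c - 2 ∨ ∃ j : k[X], HasFullTorsion Q W j ∧ 0 < j.natDegree ∧
      ∀ n, ∃ a : k[X], ∀ x : W, j ^ n • x = 0 → F x = a • x := by
  classical
  by_cases hdvd : i ∣ c - 2
  · exact Or.inl hdvd
  right
  set d := EuclideanDomain.gcd i (c - 2) with hd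
  have hd0 : d ≠ 0 := fun h0 => hi.1 (EuclideanDomain.gcd_eq_zero_iff.1 h0).1
  obtain ⟨j, hj⟩ := EuclideanDomain.gcd_dvd_left i (c - 2)
  obtain ⟨m, hm⟩ := EuclideanDomain.gcd_dvd_right i (c - 2)
  rw [← hd] at hj hm
  have hfd : HasFullTorsion Q W d := by rw [hj] at hi; exact hi.of_mul_left hW
  have hfj : HasFullTorsion Q W j := by rw [hj, mul_comm] at hi; exact hi.of_mul_left hW
  have huw : EuclideanDomain.gcdB i (c - 2) * m + EuclideanDomain.gcdA i (c - 2) * j = 1 := by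
    have h1 := EuclideanDomain.gcd_eq_gcd_ab i (c - 2)
    rw [← hd] at h1
    apply mul_left_cancel₀ hd0
    linear_combination -h1 + EuclideanDomain.gcdA i (c - 2) * (-hj) -
      EuclideanDomain.gcdB i (c - 2) * hm
  have hjd : 0 < j.natDegree := by
    rw [Nat.pos_iff_ne_zero]
    intro h0
    have hu : IsUnit j := isUnit_iff_degree_eq_zero.2 (by rw [degree_eq_natDegree hfj.1, h0]; rfl)
    exact hdvd (by rw [hj, hm, hu.mul_right_dvd]; exact dvd_mul_right _ _)
  obtain ⟨g, hg⟩ := exists_eq_smul_of_torsionBy_le_ker (hW.surjective_smul i hi.1)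
    (f := F - LinearMap.id) (fun x hx => by simp [hFi x hx])
  have hFg : ∀ x, F x = x + (d * j) • g x := fun x => by
    rw [← hj, ← hg x]; simp
  have hc : c = 2 + d * m := by linear_combination hm
  have key : ∀ x, (1 - c + N) • x + (d ^ 2) • (j • g (j • g x) - m • j • g x) = 0 := fun x => by
    rw [← hF x]
    simp only [hFg, map_add, map_smul, hc]
    module
  -- `1 - c + N` is the value of `X² - cX + N` at `1`. It kills `W[d²]`, which is full, so `d²` can
  -- be cancelled from the whole equation.
  obtain ⟨N', hN'⟩ := (hfd.pow hW 2).dvd hW (b := 1 - c + N) fun x hx => by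
    have h0 : d ^ 2 • ((j • g) ∘ₗ (j • g) - m • j • g : W →ₗ[k[X]] W) x = 0 := by
      rw [← map_smul, hx, map_zero]
    have := key x
    exact (add_eq_left.2 h0).symm.trans this
  have key2 : ∀ x, (N' • LinearMap.id + ((j • g) ∘ₗ (j • g) - m • j • g) : W →ₗ[k[X]] W) x = 0 := by
    refine eq_zero_of_forall_smul_eq_zero (hW.surjective_smul _ (hfd.pow hW 2).1) fun x => ?_
    rw [← key x, hN']
    simp only [LinearMap.add_apply, LinearMap.sub_apply, LinearMap.smul_apply, LinearMap.id_apply,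
      LinearMap.comp_apply]
    module
  refine ⟨j, hfj, hjd, fun n => ?_⟩
  obtain ⟨b, h, -, hb⟩ := exists_scalar_congr_pow (G := j • g) (N := N') huw
    (fun n => hW.surjective_smul _ (hfj.pow hW n).1) (fun n a => (hfj.pow hW n).dvd hW)
    (fun x => by
      rw [← key2 x]
      simp only [LinearMap.add_apply, LinearMap.sub_apply, LinearMap.smul_apply,
        LinearMap.id_apply, LinearMap.comp_apply]
      module) (fun x => LinearMap.smul_apply _ _ _) n
  refine ⟨1 + d * b, fun x hx => ?_⟩
  have hb' := hb x
  rw [← map_smul, pow_succ', mul_smul, hx, smul_zero, map_zero, add_zero,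
    LinearMap.smul_apply] at hb'
  rw [hFg, mul_smul, hb']
  module

end FullTorsion

theorem card_quotient_span {k : Type*} [Field k] [Fintype k] (f : k[X])
    [Finite (k[X] ⧸ Ideal.span {f})] :
    Nat.card (k[X] ⧸ Ideal.span {f}) = Fintype.card k ^ f.natDegree := by
  have := Fintype.ofFinite (k[X] ⧸ Ideal.span {f})
  rw [Nat.card_eq_fintype_card, Module.card_eq_pow_finrank (K := k),
    finrank_quotient_span_eq_natDegree]

theorem ne_zero_of_finite_quotient_span {R : Type*} [CommRing R] [Infinite R] {f : R}
    [Finite (R ⧸ Ideal.span {f})] : f ≠ 0 := by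
  rintro rfl
  have e : R ≃ R ⧸ Ideal.span {(0 : R)} :=
    Equiv.ofBijective (Ideal.Quotient.mk _) ⟨by
      rw [RingHom.injective_iff_ker_eq_bot, Ideal.mk_ker]; simp, Ideal.Quotient.mk_surjective⟩
  have := Finite.of_equiv _ e.symm
  exact not_finite R

/-! ### Components of Tate module elements. -/

section Tate

variable {R M : Type*} [CommRing R] [AddCommGroup M] [Module R M] {l : R}

theorem tateModule.algebraMap_smul_apply (r : R) (x : tateModule R M l) (n : ℕ) :
    ((algebraMap R (AdicCompletion (Ideal.span {l}) R) r • x).1 n : M) = r • (x.1 n : M) := by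
  rw [tateModule.coe_smul_apply]
  change ((Ideal.Quotient.mk (Ideal.span {l} ^ n) r • x.1 n :
    Submodule.torsionBySet R M ↑(Ideal.span {l} ^ n)) : M) = _
  rw [Submodule.torsionBySet.mk_smul, Submodule.coe_smul]

theorem tateModule.pow_smul_apply (x : tateModule R M l) (n k : ℕ) :
    l ^ k • (x.1 (n + k) : M) = (x.1 n : M) := by
  induction k with
  | zero => simp
  | succ k ih => rw [pow_succ, mul_smul, ← add_assoc, x.2, ih]

theorem tateModule.pow_smul_apply_self (x : tateModule R M l) (n : ℕ) :
    l ^ n • (x.1 n : M) = 0 :=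
  (Submodule.mem_torsionBySet_iff _ _).1 (x.1 n).2
    ⟨l ^ n, Ideal.pow_mem_pow (Ideal.mem_span_singleton_self l) n⟩

/-- If two components beyond a nonzero `x_m` agreed, the later one, `y`, would satisfy `y = l^(e+1)
y`; being killed by a power of `l`, it would vanish, and so would `x_m`. -/
theorem tateModule.infinite_range_of_ne_zero {x : tateModule R M l} (hx : x ≠ 0) :
    (Set.range fun n => (x.1 n : M)).Infinite := by
  obtain ⟨m, hm⟩ : ∃ m, (x.1 m : M) ≠ 0 := by
    by_contra! h
    exact hx (Subtype.ext (funext fun n => Subtype.ext (h n)))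
  have hne : ∀ a e, (x.1 (m + a) : M) ≠ x.1 (m + (a + e + 1)) := fun a e h => by
    rw [show m + (a + e + 1) = m + a + (e + 1) by omega] at h
    have h1 := tateModule.pow_smul_apply x (m + a) (e + 1)
    rw [h] at h1
    have h2 : ∀ i, l ^ ((e + 1) * i) • (x.1 (m + a + (e + 1)) : M) = x.1 (m + a + (e + 1)) := by
      intro i
      induction i with
      | zero => simp
      | succ i ih => rw [Nat.mul_succ, pow_add, mul_smul, h1, ih]
    have h3 := h2 (m + a + (e + 1))
    rw [Nat.succ_mul, pow_add, mul_smul, tateModule.pow_smul_apply_self, smul_zero] at h3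
    have h4 := tateModule.pow_smul_apply x m a
    rw [h, ← h3, smul_zero] at h4
    exact hm h4.symm
  refine Set.infinite_of_injective_forall_mem (f := fun n => (x.1 (m + n) : M)) (fun a b h => ?_)
    fun n => ⟨m + n, rfl⟩
  rcases lt_trichotomy a b with hab | hab | hab
  · obtain ⟨e, rfl⟩ := Nat.exists_eq_add_of_lt hab
    exact absurd h (hne a e)
  · exact hab
  · obtain ⟨e, rfl⟩ := Nat.exists_eq_add_of_lt hab
    exact absurd h.symm (hne b e)

theorem nontrivial_adicCompletion_span (hl : ¬ IsUnit l) :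
    Nontrivial (AdicCompletion (Ideal.span {l}) R) := by
  have : Nontrivial (R ⧸ Ideal.span {l} ^ 1) := by
    rw [pow_one]
    exact Ideal.Quotient.nontrivial_iff.2 (by rwa [Ne, Ideal.span_singleton_eq_top])
  exact (AdicCompletion.surjective_evalₐ (Ideal.span {l}) 1).nontrivial

end Tate

/-! ### Drinfeld modules: the polynomials `Φ(a)`, rational torsion, and Frobenius. -/

namespace RankTwoDrinfeldModule

variable {Fq L : Type*} [Field Fq] [Fintype Fq] [Field L] [Algebra Fq L] {γ : Fq[X] →ₐ[Fq] L}
  (Φ : RankTwoDrinfeldModule γ)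

section Polynomials

variable (K : Type*) [Field K] [Algebra L K]

/-- The polynomial `γ(T) x + a₂ x^q + a₃ x^(q²)`. -/
def actTPolynomial : K[X] :=
  C (algebraMap L K (γ X)) * X + C (algebraMap L K Φ.a₂) * X ^ Fintype.card Fq +
    C (algebraMap L K Φ.a₃) * X ^ (Fintype.card Fq ^ 2)

theorem natDegree_actTPolynomial : (Φ.actTPolynomial K).natDegree = Fintype.card Fq ^ 2 := by
  have hq : 1 < Fintype.card Fq := Fintype.one_lt_card
  have h3 : algebraMap L K Φ.a₃ ≠ 0 := by simpa using Φ.a₃_ne_zero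
  have hlt : Fintype.card Fq < Fintype.card Fq ^ 2 := by nlinarith
  rw [actTPolynomial, natDegree_add_eq_right_of_natDegree_lt, natDegree_C_mul_X_pow _ _ h3]
  rw [natDegree_C_mul_X_pow _ _ h3]
  refine (natDegree_add_le _ _).trans_lt (max_lt ?_ ?_)
  · exact (natDegree_C_mul_le _ _).trans_lt (natDegree_X_le.trans_lt (hq.trans hlt))
  · exact (natDegree_C_mul_X_pow_le _ _).trans_lt hlt

variable [Algebra Fq K] [IsScalarTower Fq L K]

theorem eval_actTPolynomial (x : K) : (Φ.actTPolynomial K).eval x = Φ.actT K x := by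
  simp [actTPolynomial, actT_apply, Algebra.smul_def]

/-- Turns identities between operators on `K^Φ` into identities between polynomials, which can be
proved by counting roots. -/
theorem exists_polynomial_smul (a : Fq[X]) :
    ∃ p : K[X], (a ≠ 0 → p.natDegree = (Fintype.card Fq ^ 2) ^ a.natDegree) ∧ (a = 0 → p = 0) ∧
      ∀ x : K, a • Module.AEval'.of (Φ.actT K) x = Module.AEval'.of (Φ.actT K) (p.eval x) := by
  have hq : 1 < Fintype.card Fq ^ 2 := Nat.one_lt_pow two_ne_zero Fintype.one_lt_card
  induction a using recOnHorner with
  | M0 => exact ⟨0, by simp, by simp, by simp⟩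
  | MC b r hb hr ih =>
    obtain ⟨p, hp, hp0, hpx⟩ := ih
    have hne : b + C r ≠ 0 := fun h => hr (by simpa [hb] using congrArg (coeff · 0) h)
    have hr' : algebraMap Fq K r ≠ 0 := by simpa using hr
    refine ⟨p + C (algebraMap Fq K r) * X, fun _ => ?_, fun h => absurd h hne, fun x => ?_⟩
    · rw [natDegree_add_C]
      by_cases h0 : b = 0
      · rw [hp0 h0, h0, zero_add, natDegree_C_mul_X _ hr']; simp
      · have hd : b.natDegree ≠ 0 := fun h => h0 (by
          rw [eq_C_of_natDegree_eq_zero h, hb, C_0])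
        rw [natDegree_add_eq_left_of_natDegree_lt, hp h0]
        rw [natDegree_C_mul_X _ hr', hp h0]
        exact Nat.one_lt_pow hd hq
    · rw [add_smul, hpx, Module.AEval.C_smul, ← map_smul, ← map_add, eval_add, eval_mul, eval_C,
        eval_X, Algebra.smul_def]
  | MX b hb ih =>
    obtain ⟨p, hp, -, hpx⟩ := ih
    refine ⟨p.comp (Φ.actTPolynomial K), fun _ => ?_, fun h => absurd h (mul_ne_zero hb X_ne_zero),
      fun x => ?_⟩
    · rw [natDegree_comp, hp hb, natDegree_actTPolynomial, natDegree_mul_X hb, ← pow_succ]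
    · rw [mul_smul, Module.AEval'.X_smul_of, hpx, eval_comp, eval_actTPolynomial]

variable {K}

theorem finite_and_ncard_le_of_eval_eq_zero {p : K[X]} (hp : p ≠ 0) {S : Set (Φ.points K)}
    (hS : ∀ x : K, Module.AEval'.of (Φ.actT K) x ∈ S → p.eval x = 0) :
    S.Finite ∧ S.ncard ≤ p.natDegree := by
  classical
  have hsub : S ⊆ Module.AEval'.of (Φ.actT K) '' (p.roots.toFinset : Set K) := fun y hy => by
    obtain ⟨x, rfl⟩ := (Module.AEval'.of (Φ.actT K)).surjective y
    exact ⟨x, by simpa [hp] using hS x hy, rfl⟩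
  have hfin := (p.roots.toFinset.finite_toSet.image (Module.AEval'.of (Φ.actT K)))
  refine ⟨hfin.subset hsub, (Set.ncard_le_ncard hsub hfin).trans <|
    (Set.ncard_image_le p.roots.toFinset.finite_toSet).trans ?_⟩
  rw [Set.ncard_coe_finset]
  exact (Multiset.toFinset_card_le _).trans (card_roots' p)

theorem hasBoundedTorsion [IsAlgClosed K] :
    HasBoundedTorsion (k := Fq) (Fintype.card Fq ^ 2) (Φ.points K) := by
  have hq : 1 < Fintype.card Fq ^ 2 := Nat.one_lt_pow two_ne_zero Fintype.one_lt_card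
  have key : ∀ a : Fq[X], a ≠ 0 →
      (Submodule.torsionBy Fq[X] (Φ.points K) a : Set (Φ.points K)).Finite ∧
      (Submodule.torsionBy Fq[X] (Φ.points K) a : Set (Φ.points K)).ncard ≤
        (Fintype.card Fq ^ 2) ^ a.natDegree := fun a ha => by
    obtain ⟨p, hp, -, hpx⟩ := Φ.exists_polynomial_smul K a
    have hp0 : p ≠ 0 := fun h => by
      have := hp ha
      rw [h, natDegree_zero] at this
      exact absurd this.symm (pow_pos (zero_lt_one.trans hq) _).ne'
    rw [← hp ha]
    refine Φ.finite_and_ncard_le_of_eval_eq_zero hp0 fun x hx => ?_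
    rw [SetLike.mem_coe, Submodule.mem_torsionBy_iff, hpx] at hx
    simpa using hx
  refine ⟨hq, fun a ha y => ?_, fun a ha => (key a ha).1.to_subtype, fun a ha => (key a ha).2⟩
  obtain ⟨p, hp, -, hpx⟩ := Φ.exists_polynomial_smul K a
  obtain ⟨y, rfl⟩ := (Module.AEval'.of (Φ.actT K)).surjective y
  have hdeg : (p - C y).natDegree ≠ 0 := by
    rw [natDegree_sub_C, hp ha]
    exact (pow_pos (zero_lt_one.trans hq) _).ne'
  obtain ⟨x, hx⟩ := IsAlgClosed.exists_root (p - C y) fun h => hdeg (natDegree_eq_of_degree_eq_some h)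
  refine ⟨Module.AEval'.of (Φ.actT K) x, ?_⟩
  simp only [hpx]
  rw [IsRoot.def, eval_sub, eval_C, sub_eq_zero] at hx
  rw [hx]

end Polynomials

/-- The inclusion `L^Φ → K^Φ`. -/
def pointsInclusion (K : Type*) [Field K] [Algebra Fq K] [Algebra L K] [IsScalarTower Fq L K] :
    Φ.points L →ₗ[Fq[X]] Φ.points K :=
  LinearMap.ofAEval (Φ.actT L)
    ((Module.AEval'.of (Φ.actT K)).toLinearMap ∘ₗ (IsScalarTower.toAlgHom Fq L K).toLinearMap)
    (fun x => by
      rw [LinearMap.comp_apply, LinearMap.comp_apply, LinearEquiv.coe_coe,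
        Module.AEval'.X_smul_of]
      congr 1
      simp [actT_apply, Algebra.smul_def])

theorem pointsInclusion_of (K : Type*) [Field K] [Algebra Fq K] [Algebra L K]
    [IsScalarTower Fq L K] (x : L) :
    Φ.pointsInclusion K (Module.AEval'.of (Φ.actT L) x) =
      Module.AEval'.of (Φ.actT K) (algebraMap L K x) :=
  rfl

theorem pointsInclusion_injective (K : Type*) [Field K] [Algebra Fq K] [Algebra L K]
    [IsScalarTower Fq L K] : Function.Injective (Φ.pointsInclusion K) := fun x y h => by
  obtain ⟨x, rfl⟩ := (Module.AEval'.of (Φ.actT L)).surjective x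
  obtain ⟨y, rfl⟩ := (Module.AEval'.of (Φ.actT L)).surjective y
  rw [pointsInclusion_of, pointsInclusion_of, EmbeddingLike.apply_eq_iff_eq] at h
  rw [(algebraMap L K).injective h]

variable [Fintype L]

/-- If `L^Φ ≃ A/(i₁) ⊕ A/(i₂)` with `i₂ ∣ i₁`, then all of the `i₂`-torsion over an algebraically
closed field is rational over `L`, and is as large as possible. -/
theorem hasFullTorsion_and_frobenius_eq {K : Type*} [Field K] [Algebra Fq K] [Algebra L K]
    [IsScalarTower Fq L K] [IsAlgClosed K] {i₁ i₂ : Fq[X]} (hi : i₂ ∣ i₁)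
    (e : Φ.points L ≃ₗ[Fq[X]] (Fq[X] ⧸ Ideal.span {i₁}) × (Fq[X] ⧸ Ideal.span {i₂})) :
    HasFullTorsion (Fintype.card Fq ^ 2) (Φ.points K) i₂ ∧
      ∀ x : Φ.points K, i₂ • x = 0 → Φ.frobenius K x = x := by
  have hfinL : Finite (Φ.points L) := Finite.of_equiv L (Module.AEval'.of (Φ.actT L)).toEquiv
  have hfin : Finite ((Fq[X] ⧸ Ideal.span {i₁}) × (Fq[X] ⧸ Ideal.span {i₂})) :=
    Finite.of_equiv _ e.toEquiv
  have hfin₁ : Finite (Fq[X] ⧸ Ideal.span {i₁}) := Finite.prod_left (Fq[X] ⧸ Ideal.span {i₂})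
  have hfin₂ : Finite (Fq[X] ⧸ Ideal.span {i₂}) := Finite.prod_right (Fq[X] ⧸ Ideal.span {i₁})
  have h₁ : i₁ ≠ 0 := ne_zero_of_finite_quotient_span
  have h₂ : i₂ ≠ 0 := ne_zero_of_finite_quotient_span
  obtain ⟨t, rfl⟩ := hi
  have ht : t ≠ 0 := right_ne_zero_of_mul h₁
  -- Multiplication by `t = i₁ / i₂` embeds `A/(i₂)` in `A/(i₁)`.
  let s : (Fq[X] ⧸ Ideal.span {i₂}) →ₗ[Fq[X]] (Fq[X] ⧸ Ideal.span {i₂ * t}) :=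
    Submodule.mapQ _ _ (LinearMap.lsmul Fq[X] Fq[X] t) fun x hx => by
      rw [Ideal.mem_span_singleton] at hx
      rw [Submodule.mem_comap, Ideal.mem_span_singleton, LinearMap.lsmul_apply, smul_eq_mul,
        mul_comm t]
      exact mul_dvd_mul_right hx t
  have hs : Function.Injective s := by
    rw [injective_iff_map_eq_zero]
    intro x hx
    obtain ⟨x, rfl⟩ := Submodule.Quotient.mk_surjective _ x
    have hx' : (Submodule.Quotient.mk (t * x) : Fq[X] ⧸ Ideal.span {i₂ * t}) = 0 := hx
    rw [Submodule.Quotient.mk_eq_zero, Ideal.mem_span_singleton, mul_comm,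
      mul_dvd_mul_iff_left ht] at hx'
    rw [Submodule.Quotient.mk_eq_zero, Ideal.mem_span_singleton]
    exact hx'
  let f : (Fq[X] ⧸ Ideal.span {i₂}) × (Fq[X] ⧸ Ideal.span {i₂}) →ₗ[Fq[X]] Φ.points K :=
    Φ.pointsInclusion K ∘ₗ e.symm.toLinearMap ∘ₗ s.prodMap LinearMap.id
  have hf : Function.Injective f :=
    (Φ.pointsInclusion_injective K).comp (e.symm.injective.comp (hs.prodMap Function.injective_id))
  have hmk : ∀ y : Fq[X] ⧸ Ideal.span {i₂}, i₂ • y = 0 := fun y => by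
    obtain ⟨y, rfl⟩ := Submodule.Quotient.mk_surjective _ y
    rw [← Submodule.Quotient.mk_smul, Submodule.Quotient.mk_eq_zero, Ideal.mem_span_singleton]
    exact dvd_mul_right _ _
  have hW := Φ.hasBoundedTorsion (K := K)
  have := hW.finite_torsionBy i₂ h₂
  let f' : (Fq[X] ⧸ Ideal.span {i₂}) × (Fq[X] ⧸ Ideal.span {i₂}) →
      Submodule.torsionBy Fq[X] (Φ.points K) i₂ := fun y => ⟨f y, by
    rw [Submodule.mem_torsionBy_iff, ← map_smul, Prod.smul_def, hmk, hmk]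
    exact map_zero f⟩
  have hf' : Function.Injective f' := fun x y h => hf (congrArg Subtype.val h)
  have hcard : Nat.card ((Fq[X] ⧸ Ideal.span {i₂}) × (Fq[X] ⧸ Ideal.span {i₂})) =
      (Fintype.card Fq ^ 2) ^ i₂.natDegree := by
    rw [Nat.card_prod, card_quotient_span, ← sq, ← pow_mul, ← pow_mul, mul_comm]
  have hle := hW.card_torsionBy_le i₂ h₂
  refine ⟨⟨h₂, hle.antisymm (hcard ▸ Nat.card_le_card_of_injective f' hf')⟩, fun x hx => ?_⟩
  -- The embedded `(A/i₂)²` already attains the bound on the torsion, so every `i₂`-torsion point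
  -- has coordinate in `L`.
  obtain ⟨y, hy⟩ := (hf'.bijective_of_nat_card_le (hcard ▸ hle)).2 ⟨x, hx⟩
  obtain ⟨z, hz⟩ : ∃ z, Φ.pointsInclusion K z = x := ⟨_, congrArg Subtype.val hy⟩
  obtain ⟨z, rfl⟩ := (Module.AEval'.of (Φ.actT L)).surjective z
  rw [← hz, pointsInclusion_of, frobenius_of, ← map_pow, FiniteField.pow_card]

/-- The Frobenius is a scalar as soon as it is one on sufficiently large torsion. -/
theorem exists_frobenius_eq_smul {K : Type*} [Field K] [Algebra Fq K] [Algebra L K]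
    [IsScalarTower Fq L K] [IsAlgClosed K] {j : Fq[X]}
    (hj : HasFullTorsion (Fintype.card Fq ^ 2) (Φ.points K) j) (hdeg : 0 < j.natDegree)
    (h : ∀ n, ∃ a : Fq[X], ∀ x : Φ.points K, j ^ n • x = 0 → Φ.frobenius K x = a • x) :
    ∃ a : Fq[X], ∀ x : Φ.points K, Φ.frobenius K x = a • x := by
  have hW := Φ.hasBoundedTorsion (K := K)
  have hfull := hj.pow hW (Fintype.card L)
  -- The exponent `|L|` gives `deg j^|L| ≥ |L|`, so `W[j^|L|]` has more than `|L|` elements.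
  -- Reducing `a` modulo `j^|L|` makes the degree of `Φ(a)` smaller than that order too.
  obtain ⟨a, ha⟩ := h (Fintype.card L)
  have hnd : 0 < (j ^ Fintype.card L).natDegree := by
    rw [natDegree_pow]; exact Nat.mul_pos Fintype.card_pos hdeg
  obtain ⟨p, hp, hp0, hpx⟩ := Φ.exists_polynomial_smul K (a % j ^ Fintype.card L)
  have hzero : X ^ Fintype.card L - p = 0 := by
    by_contra hne
    have hle := (Φ.finite_and_ncard_le_of_eval_eq_zero hne
      (S := Submodule.torsionBy Fq[X] (Φ.points K) (j ^ Fintype.card L)) fun x hx => ?_).2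
    · rw [← Nat.card_coe_set_eq] at hle
      have hlt := (hfull.2.symm.trans_le hle)
      refine hlt.not_gt ((natDegree_sub_le _ _).trans_lt (max_lt ?_ ?_))
      · rw [natDegree_X_pow]
        calc Fintype.card L ≤ (j ^ Fintype.card L).natDegree := by
              rw [natDegree_pow]; exact Nat.le_mul_of_pos_right _ hdeg
          _ < _ := Nat.lt_pow_self hW.one_lt
      · by_cases hr : a % j ^ Fintype.card L = 0
        · rw [hp0 hr, natDegree_zero]
          exact pow_pos (zero_lt_one.trans hW.one_lt) _
        · rw [hp hr]
          exact Nat.pow_lt_pow_right hW.one_lt (natDegree_mod_lt a hnd.ne')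
    · rw [SetLike.mem_coe, Submodule.mem_torsionBy_iff] at hx
      have h1 := ha _ hx
      rw [frobenius_of, ← EuclideanDomain.mod_add_div a (j ^ Fintype.card L), add_smul, mul_comm,
        mul_smul, hx, smul_zero, add_zero, hpx, EmbeddingLike.apply_eq_iff_eq] at h1
      simp [h1]
  refine ⟨a % j ^ Fintype.card L, fun x => ?_⟩
  obtain ⟨x, rfl⟩ := (Module.AEval'.of (Φ.actT K)).surjective x
  rw [frobenius_of, hpx, ← sub_eq_zero.1 hzero, eval_pow, eval_X]

/-! ### Consequences of the characteristic polynomial of Frobenius. -/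

section Charpoly

variable {l c N : Fq[X]}

/-- By Cayley-Hamilton the relation holds on every component of a nonzero Tate vector. These are
infinitely many roots of one polynomial, which is therefore zero. -/
theorem IsFrobeniusCharpoly.frobenius_sq_sub_add_eq_zero (hl : ¬ IsUnit l)
    (h : Φ.IsFrobeniusCharpoly l (X ^ 2 - C c * X + C N)) (x : Φ.points (AlgebraicClosure L)) :
    Φ.frobenius _ (Φ.frobenius _ x) - c • Φ.frobenius _ x + N • x = 0 := by
  obtain ⟨b, hb⟩ := h
  have := nontrivial_adicCompletion_span hl
  have := Module.Free.of_basis b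
  have := Module.Finite.of_basis b
  rw [LinearMap.charpoly_toMatrix] at hb
  have hCH := LinearMap.aeval_self_charpoly
    (tateModule.map (l := l) (Φ.frobenius (AlgebraicClosure L)))
  rw [hb] at hCH
  simp only [Polynomial.map_add, Polynomial.map_sub, Polynomial.map_mul, Polynomial.map_pow,
    map_X, map_C, map_add, map_sub, map_mul, map_pow, aeval_X, aeval_C] at hCH
  have hroot : ∀ n, Φ.frobenius _ (Φ.frobenius _ ((b 0).1 n : Φ.points (AlgebraicClosure L))) -
      c • Φ.frobenius _ ((b 0).1 n : Φ.points (AlgebraicClosure L)) +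
      N • ((b 0).1 n : Φ.points (AlgebraicClosure L)) = 0 := fun n => by
    have h1 := congrArg (fun y => (y.1 n : Φ.points (AlgebraicClosure L)))
      (LinearMap.congr_fun hCH (b 0))
    have h2 := tateModule.algebraMap_smul_apply N (b 0) n
    have h3 := tateModule.algebraMap_smul_apply c
      (tateModule.map (Φ.frobenius (AlgebraicClosure L)) (b 0)) n
    rw [← h2]
    refine (congrArg (fun y => _ - y + _) h3.symm).trans ?_
    exact h1
  obtain ⟨p, -, -, hp⟩ := Φ.exists_polynomial_smul (AlgebraicClosure L) c
  obtain ⟨r, -, -, hr⟩ := Φ.exists_polynomial_smul (AlgebraicClosure L) N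
  have heval : ∀ x : AlgebraicClosure L,
      Φ.frobenius _ (Φ.frobenius _ (Module.AEval'.of (Φ.actT _) x)) -
      c • Φ.frobenius _ (Module.AEval'.of (Φ.actT _) x) + N • Module.AEval'.of (Φ.actT _) x =
      Module.AEval'.of (Φ.actT _)
        ((X ^ (Fintype.card L * Fintype.card L) - p.comp (X ^ Fintype.card L) + r).eval x) :=
    fun x => by
      simp only [frobenius_of, hp, hr, eval_add, eval_sub, eval_comp, eval_pow, eval_X, map_add,
        map_sub, pow_mul]
  have hzero : X ^ (Fintype.card L * Fintype.card L) - p.comp (X ^ Fintype.card L) + r = 0 := by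
    by_contra hne
    refine tateModule.infinite_range_of_ne_zero (b.ne_zero 0)
      (Φ.finite_and_ncard_le_of_eval_eq_zero hne fun x hx => ?_).1
    obtain ⟨n, hn⟩ := hx
    have := hroot n
    simp only at hn
    rw [hn, heval, LinearEquiv.map_eq_zero_iff] at this
    exact this
  obtain ⟨x, rfl⟩ := (Module.AEval'.of (Φ.actT _)).surjective x
  rw [heval, hzero, eval_zero, map_zero]

theorem IsFrobeniusCharpoly.eq_two_mul_of_frobenius_eq_smul (hl : ¬ IsUnit l)
    (h : Φ.IsFrobeniusCharpoly l (X ^ 2 - C c * X + C N)) {a : Fq[X]}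
    (ha : ∀ x : Φ.points (AlgebraicClosure L), Φ.frobenius _ x = a • x) : c = 2 * a := by
  obtain ⟨b, hb⟩ := h
  have := nontrivial_adicCompletion_span hl
  have hmap : tateModule.map (l := l) (Φ.frobenius (AlgebraicClosure L)) =
      algebraMap Fq[X] (AdicCompletion (Ideal.span {l}) Fq[X]) a • LinearMap.id :=
    LinearMap.ext fun x => Subtype.ext <| funext fun n => Subtype.ext <| by
      rw [LinearMap.smul_apply, tateModule.algebraMap_smul_apply]
      exact ha _
  have hc : algebraMap Fq[X] (AdicCompletion (Ideal.span {l}) Fq[X]) (c - 2 * a) = 0 := by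
    have h1 := congrArg (fun f => coeff f 1) hb
    rw [hmap] at h1
    simp [Matrix.charpoly_fin_two, coeff_C] at h1
    rw [Algebra.smul_def] at h1
    rw [map_sub, map_mul, map_ofNat]
    linear_combination -h1
  -- `c - 2a` is so far zero only in the completion. Were it nonzero in `A`, the infinitely many
  -- components of a basis vector would lie in its finite torsion.
  by_contra hne
  have hW := Φ.hasBoundedTorsion (K := AlgebraicClosure L)
  have := hW.finite_torsionBy _ (sub_ne_zero.2 hne)
  refine tateModule.infinite_range_of_ne_zero (b.ne_zero 0)
    ((Set.toFinite (Submodule.torsionBy Fq[X] (Φ.points (AlgebraicClosure L))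
      (c - 2 * a) : Set (Φ.points (AlgebraicClosure L)))).subset ?_)
  rintro _ ⟨n, rfl⟩
  rw [SetLike.mem_coe, Submodule.mem_torsionBy_iff]
  simp only
  rw [← tateModule.algebraMap_smul_apply, hc]
  exact congrArg (fun y => (y.1 n : Φ.points (AlgebraicClosure L)))
    (zero_smul (AdicCompletion (Ideal.span {l}) Fq[X]) (b 0))

end Charpoly

end RankTwoDrinfeldModule

end

theorem proposition2p2 {Fq L : Type*} [Field Fq] [Fintype Fq] [Field L] [Fintype L] [Algebra Fq L]
    (γ : Fq[X] →ₐ[Fq] L) (P : Fq[X]) (hP : RingHom.ker γ = Ideal.span {P})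
    (Φ : RankTwoDrinfeldModule γ)
    (l : Fq[X]) (hl : Irreducible l) (hlP : ¬ P ∣ l)
    (c : Fq[X]) (μ : Fqˣ)
    (hc : Φ.IsFrobeniusCharpoly l
      (X ^ 2 - C c * X + C (C (μ : Fq) * P ^ Module.finrank γ.range L)))
    (i₁ i₂ : Fq[X]) (hi : i₂ ∣ i₁)
    (hL : Nonempty
      (Φ.points L ≃ₗ[Fq[X]] (Fq[X] ⧸ Ideal.span {i₁}) × (Fq[X] ⧸ Ideal.span {i₂}))) :
    i₂ ∣ c - 2 := by
  obtain ⟨e⟩ := hL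
  have hW := Φ.hasBoundedTorsion (K := AlgebraicClosure L)
  obtain ⟨hfull, hfix⟩ := Φ.hasFullTorsion_and_frobenius_eq (K := AlgebraicClosure L) hi e
  obtain h | ⟨j, hj, hdeg, hscalar⟩ := dvd_or_exists_scalar_congr hW hfull
    (hc.frobenius_sq_sub_add_eq_zero Φ hl.not_isUnit) hfix
  · exact h
  · obtain ⟨a, ha⟩ := Φ.exists_frobenius_eq_smul hj hdeg hscalar
    have hdvd : i₂ ∣ a - 1 := hfull.dvd hW fun x hx => by
      rw [sub_smul, one_smul, ← ha, hfix x hx, sub_self]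
    rw [hc.eq_two_mul_of_frobenius_eq_smul Φ hl.not_isUnit ha,
      show 2 * a - 2 = 2 * (a - 1) by ring]
    exact hdvd.mul_left 2
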